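/- Let $R$ be a ring. A submodule $L$ of an $R$-module $M$ is a fully invariant direct summand of $M$ if it is a direct summand of $M$ and $h(L)\subseteq L$ for every endomorphism $h$ of $M$. An $R$-module $M$ is called strongly self-regular if, for every endomorphism $f$ of $M$, both $\operatorname{Ker}(f)$ and $\operatorname{Im}(f)$ are fully invariant direct summands of $M$. An abelian group is called strongly self-regular if it is so as a $\mathbb{Z}$-module. (A) Let $R$ be a Dedekind domain with quotient field $K$. (i) A non-zero torsion $R$-module $M$ is strongly self-regular if and only if $M\cong\bigoplus_{i\in I}R/P_i$ for some family $(P_i)_{i\in I}$ of pairwise distinct maximal ideals of $R$. (ii) A non-zero finitely generated $R$-module $M$ is strongly self-regular if and only if $M\cong\bigoplus_{i=1}^{k}R/P_i$ for some natural number $k$ and some pairwise distinct maximal ideals $P_1,\dots,P_k$ of $R$. (iii) A non-zero injective $R$-module $M$ is strongly self-regular if and only if $M\cong K$ as $R$-modules. (B) (i) A non-zero torsion abelian group $G$ is strongly self-regular if and only if $G\cong\bigoplus_{i\in I}\mathbb{Z}_{p_i}$ for some family $(p_i)_{i\in I}$ of pairwise distinct primes, where $\mathbb{Z}_p=\mathbb{Z}/p\mathbb{Z}$.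 (ii) A non-zero finitely generated abelian group $G$ is strongly self-regular if and only if $G\cong\bigoplus_{i=1}^{k}\mathbb{Z}_{p_i}$ for some natural number $k$ and some pairwise distinct primes $p_1,\dots,p_k$. (iii) A non-zero injective abelian group $G$ is strongly self-regular if and only if $G\cong\mathbb{Q}$. -/

import Mathlib

open scoped DirectSum

universe u v w x

/-- A submodule `L` of `M` is a fully invariant direct summand of `M` if it is a direct summand
(it has a complement in the lattice of submodules) and every endomorphism of `M` maps it into
itself. -/
def IsFullyInvariantSummand {R : Type*} [Ring R] {M : Type*} [AddCommGroup M] [Module R M]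
    (L : Submodule R M) : Prop :=
  IsComplemented L ∧ L.IsFullyInvariant

/-- `N` is strongly `M`-regular if for every homomorphism `f : M → N`, the kernel of `f` is a fully
invariant direct summand of `M` and the image of `f` is a fully invariant direct summand
of `N`. -/
def IsStronglyRegular (R : Type*) [Ring R] (M N : Type*) [AddCommGroup M] [Module R M]
    [AddCommGroup N] [Module R N] : Prop :=
  ∀ f : M →ₗ[R] N,
    IsFullyInvariantSummand (LinearMap.ker f) ∧ IsFullyInvariantSummand (LinearMap.range f)

/-- `M` is strongly self-regular if it is strongly `M`-regular. Abelian groups are treated as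
modules over `ℤ`. -/
def IsStronglySelfRegular (R : Type*) [Ring R] (M : Type*) [AddCommGroup M] [Module R M] : Prop :=
  IsStronglyRegular R M M

/-!
# Strongly self-regular modules over Dedekind domains

Let `M` be strongly self-regular over a commutative ring `R`. Applying the definition to
multiplication by `r` shows that `r² x = 0` implies `r x = 0` and that `r M = r² M`.

* If `R` is Dedekind and `M` is torsion, annihilators of elements are therefore non-zero radical
  ideals, so cyclic submodules, and then `M` itself, are semisimple
  (`IsStronglySelfRegular.isSemisimpleModule_of_isTorsion`). If `M` is finitely generated and `R`
  is not a field, `r M = r² M` and Nakayama's lemma show that `M` is torsion; over a field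
  semisimplicity is automatic.
* In a semisimple module, full invariance of images forces each simple module to occur at most once
  (`mem_span_singleton_of_range_isFullyInvariant`), so `M` is a direct sum of modules `R ⧸ P` with
  distinct `P`. Conversely, an endomorphism of such a sum maps every element to one of its
  multiples, so every submodule is fully invariant (`isStronglySelfRegular_directSum_quotient`).
* An injective `M` is divisible, and then `r² x = 0 → r x = 0` makes it torsion-free. Hence it is a
  vector space over the field of fractions `K`, and multiplicity one, now over `K`, makes it
  one-dimensional. Conversely, every `R`-endomorphism of `K` is multiplication by an element of `K`.

The statements on abelian groups are the case `R = ℤ`, with maximal ideals of `ℤ` replaced by primes.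
-/

open scoped nonZeroDivisors

/-! ### Multiplication by a scalar on a strongly self-regular module -/

section Scalars

variable {R : Type*} [CommRing R] {M : Type*} [AddCommGroup M] [Module R M]

/-- If `M = ker r ⊕ D`, then multiplication by `r` maps `M` into `D`, so its image meets its kernel
trivially. Consequently annihilators of elements are radical ideals. -/
theorem IsStronglySelfRegular.smul_eq_zero_of_smul_smul_eq_zero
    (h : IsStronglySelfRegular R M) {r : R} {x : M} (hx : r • r • x = 0) : r • x = 0 := by
  obtain ⟨D, hD⟩ := (h (LinearMap.lsmul R M r)).1.1
  obtain ⟨k, hk, d, hd, rfl⟩ :=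
    Submodule.mem_sup.1 (hD.codisjoint.eq_top.symm ▸ Submodule.mem_top (x := x))
  have hk' : r • k = 0 := by simpa using hk
  refine Submodule.disjoint_def.1 hD.disjoint _ (by simpa using hx) ?_
  rw [smul_add, hk', zero_add]
  exact D.smul_mem _ hd

/-- If `M = r M ⊕ C`, then `r C ⊆ r M ∩ C = 0`, so `r M = r² M`. -/
theorem IsStronglySelfRegular.exists_smul_smul_eq
    (h : IsStronglySelfRegular R M) (r : R) (x : M) : ∃ y : M, r • r • y = r • x := by
  obtain ⟨C, hC⟩ := (h (LinearMap.lsmul R M r)).2.1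
  obtain ⟨_, ⟨y, rfl⟩, c, hc, rfl⟩ :=
    Submodule.mem_sup.1 (hC.codisjoint.eq_top.symm ▸ Submodule.mem_top (x := x))
  have hc' : r • c = 0 :=
    Submodule.disjoint_def.1 hC.disjoint _ ⟨c, rfl⟩ (C.smul_mem _ hc)
  exact ⟨y, by simp [hc']⟩

theorem IsStronglySelfRegular.congr {N : Type*} [AddCommGroup N] [Module R N] (e : M ≃ₗ[R] N)
    (h : IsStronglySelfRegular R M) : IsStronglySelfRegular R N := by
  have key (L : Submodule R M) (hL : IsFullyInvariantSummand L) :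
      IsFullyInvariantSummand (L.map e.toLinearMap) := by
    obtain ⟨⟨C, hC⟩, hinv⟩ := hL
    refine ⟨⟨C.map e.toLinearMap, (Submodule.orderIsoMapComap e).isCompl hC⟩, fun f ↦ ?_⟩
    rintro _ ⟨x, hx, rfl⟩
    exact ⟨_, hinv (e.symm.toLinearMap ∘ₗ f ∘ₗ e.toLinearMap) hx, by simp⟩
  intro f
  have hf := h (e.symm.toLinearMap ∘ₗ f ∘ₗ e.toLinearMap)
  refine ⟨?_, ?_⟩
  · convert key _ hf.1
    ext y
    simp [Submodule.mem_map_equiv]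
  · convert key _ hf.2
    ext y
    simp [Submodule.mem_map_equiv, LinearMap.mem_range, e.symm_apply_eq,
      e.surjective.exists]

end Scalars

/-! ### Semisimple modules with pairwise non-isomorphic simple summands -/

section Semisimple

variable {R : Type u} [CommRing R] {M : Type v} [AddCommGroup M] [Module R M]

/-- A semisimple module all of whose endomorphisms have fully invariant image contains each simple
module at most once: if `x ≠ 0` and `y` are both killed by the maximal ideal `P`, then `R ∙ x` is
the image of an endomorphism, and some endomorphism sends `x` to `y`. -/
theorem mem_span_singleton_of_range_isFullyInvariant [IsSemisimpleModule R M]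
    (h : ∀ f : M →ₗ[R] M, (LinearMap.range f).IsFullyInvariant) (P : Ideal R) [P.IsMaximal]
    {x y : M} (hx : x ≠ 0) (hPx : ∀ p ∈ P, p • x = 0) (hPy : ∀ p ∈ P, p • y = 0) :
    y ∈ R ∙ x := by
  have hsimple : IsSimpleModule R (R ⧸ P) :=
    isSimpleModule_iff_isCoatom.2 (Ideal.isMaximal_def.1 ‹_›)
  -- `φ z` is the map `R ⧸ P → M` sending `1` to `z`.
  let φ (z : M) (hz : ∀ p ∈ P, p • z = 0) : (R ⧸ P) →ₗ[R] M :=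
    P.liftQ (LinearMap.toSpanSingleton R M z) hz
  have hφ (z : M) (hz : ∀ p ∈ P, p • z = 0) : φ z hz (Ideal.Quotient.mk P 1) = z :=
    (Submodule.liftQ_apply _ _ _).trans (by simp)
  have hinj : Function.Injective (φ x hPx) := LinearMap.injective_of_ne_zero fun h0 ↦ hx <| by
    rw [← hφ x hPx, h0, LinearMap.zero_apply]
  obtain ⟨π, hπ⟩ := IsSemisimpleModule.extension_property (φ x hPx) hinj LinearMap.id
  obtain ⟨g, hg⟩ := IsSemisimpleModule.extension_property (φ x hPx) hinj (φ y hPy)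
  have hrange : LinearMap.range (φ x hPx ∘ₗ π) = R ∙ x := by
    rw [LinearMap.range_comp, LinearMap.range_eq_top.2
      (LinearMap.surjective_of_comp_eq_id _ _ hπ), Submodule.map_top]
    exact (Submodule.range_liftQ _ _ _).trans (LinearMap.range_toSpanSingleton x)
  have hgx : g x = y := by
    rw [← hφ x hPx, ← LinearMap.comp_apply, hg, hφ]
  have := h (φ x hPx ∘ₗ π) g
  rw [hrange] at this
  exact hgx ▸ this (Submodule.mem_span_singleton_self x)

theorem iSupIndep_torsionBySet_maximalSpectrum :
    iSupIndep fun P : MaximalSpectrum R ↦ Submodule.torsionBySet R M (P.asIdeal : Set R) :=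
  iSupIndep_iff_supIndep.2 fun _ ↦ Submodule.supIndep_torsionBySet_ideal fun P _ Q _ hPQ ↦
    Ideal.IsMaximal.coprime_of_ne P.isMaximal Q.isMaximal fun h ↦ hPQ (MaximalSpectrum.ext h)

theorem iSup_torsionBySet_maximalSpectrum [IsSemisimpleModule R M] :
    ⨆ P : MaximalSpectrum R, Submodule.torsionBySet R M (P.asIdeal : Set R) = ⊤ := by
  rw [eq_top_iff, ← IsSemisimpleModule.sSup_simples_eq_top R M]
  refine sSup_le fun S (hS : IsSimpleModule R S) ↦ ?_
  have hmax := IsSimpleModule.annihilator_isMaximal (R := R) (M := S)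
  refine le_trans (fun x hx ↦ ?_) (le_iSup _ (⟨Module.annihilator R S, hmax⟩ : MaximalSpectrum R))
  rw [Submodule.mem_torsionBySet_iff]
  rintro ⟨a, ha⟩
  exact congrArg Subtype.val (Module.mem_annihilator.1 ha ⟨x, hx⟩)

/-- A semisimple module is the direct sum of its submodules killed by a maximal ideal, and each
non-zero one of these is simple when images of endomorphisms are fully invariant. -/
theorem exists_linearEquiv_directSum_of_isSemisimpleModule [IsSemisimpleModule R M]
    (h : ∀ f : M →ₗ[R] M, (LinearMap.range f).IsFullyInvariant) :
    ∃ (I : Type u) (P : I → MaximalSpectrum R), Function.Injective P ∧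
      Nonempty (M ≃ₗ[R] ⨁ i : I, R ⧸ (P i).asIdeal) := by
  classical
  let T (P : MaximalSpectrum R) := Submodule.torsionBySet R M (P.asIdeal : Set R)
  let I := {P : MaximalSpectrum R // T P ≠ ⊥}
  have hind : iSupIndep fun i : I ↦ T i.1 :=
    iSupIndep_torsionBySet_maximalSpectrum.comp Subtype.val_injective
  have htop : ⨆ i : I, T i.1 = ⊤ := by
    rw [← iSup_torsionBySet_maximalSpectrum (R := R) (M := M)]
    exact iSup_ne_bot_subtype T
  have hT (i : I) : Nonempty (T i.1 ≃ₗ[R] R ⧸ i.1.asIdeal) := by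
    obtain ⟨P, hP⟩ := i
    obtain ⟨x, hxT, hx0⟩ := (T P).ne_bot_iff.1 hP
    have hkill (y : M) (hy : y ∈ T P) : ∀ p ∈ P.asIdeal, p • y = 0 := fun p hp ↦
      (Submodule.mem_torsionBySet_iff _ _).1 hy ⟨p, hp⟩
    have := P.isMaximal
    have hspan : T P = R ∙ x := le_antisymm
      (fun y hy ↦ mem_span_singleton_of_range_isFullyInvariant h P.asIdeal hx0
        (hkill x hxT) (hkill y hy))
      ((Submodule.span_singleton_le_iff_mem _ _).2 hxT)
    have hker : LinearMap.ker (LinearMap.toSpanSingleton R M x) = P.asIdeal := by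
      refine (P.isMaximal.eq_of_le ?_ (hkill x hxT)).symm
      exact (Ideal.ne_top_iff_one _).2 (by simpa using hx0)
    exact ⟨(LinearEquiv.ofEq _ _ (hspan.trans (LinearMap.range_toSpanSingleton x).symm)).trans
      ((LinearMap.toSpanSingleton R M x).quotKerEquivRange.symm.trans
        (Submodule.quotEquivOfEq _ _ hker))⟩
  have hint := DirectSum.isInternal_submodule_of_iSupIndep_of_iSup_eq_top hind htop
  refine ⟨I, fun i ↦ i.1, Subtype.val_injective, ⟨?_⟩⟩
  exact (LinearEquiv.ofBijective (DirectSum.coeLinearMap fun i : I ↦ T i.1) hint).symm.trans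
    (DirectSum.congrLinearEquiv fun i ↦ (hT i).some)

theorem IsStronglySelfRegular.of_isSemisimpleModule [IsSemisimpleModule R M]
    (h : ∀ (f : M →ₗ[R] M) (x : M), f x ∈ R ∙ x) : IsStronglySelfRegular R M := by
  have key (L : Submodule R M) : IsFullyInvariantSummand L :=
    ⟨exists_isCompl L, fun f x hx ↦ (Submodule.span_singleton_le_iff_mem x L).2 hx (h f x)⟩
  exact fun f ↦ ⟨key _, key _⟩

open scoped Function in
/-- There are no non-zero maps between `R ⧸ P i` and `R ⧸ P j` for `i ≠ j`, so an endomorphism acts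
on each summand by a scalar. By the Chinese remainder theorem it then acts on each single element by
a scalar, and hence preserves every submodule. -/
theorem isStronglySelfRegular_directSum_quotient {I : Type*} (P : I → MaximalSpectrum R)
    (hP : Function.Injective P) : IsStronglySelfRegular R (⨁ i : I, R ⧸ (P i).asIdeal) := by
  classical
  have hsimple (i : I) : IsSimpleModule R (R ⧸ (P i).asIdeal) :=
    isSimpleModule_iff_isCoatom.2 (Ideal.isMaximal_def.1 (P i).isMaximal)
  have : IsSemisimpleModule R (⨁ i : I, R ⧸ (P i).asIdeal) :=
    inferInstanceAs (IsSemisimpleModule R (Π₀ i : I, R ⧸ (P i).asIdeal))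
  refine .of_isSemisimpleModule fun f x ↦ ?_
  let e (i : I) : (R ⧸ (P i).asIdeal) →ₗ[R] ⨁ i : I, R ⧸ (P i).asIdeal :=
    DirectSum.lof R I (fun i ↦ R ⧸ (P i).asIdeal) i
  have hcop : Pairwise (IsCoprime on fun i ↦ (P i).asIdeal) := fun i j hij ↦
    Ideal.isCoprime_iff_sup_eq.2 <| Ideal.IsMaximal.coprime_of_ne (P i).isMaximal (P j).isMaximal
      fun h ↦ hij (hP (MaximalSpectrum.ext h))
  -- On the `i`-th summand, `f` is determined by `f (e i 1)`, which is a multiple of `e i 1`.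
  have hscalar (i : I) : ∃ c : R, ∀ z, f (e i z) = c • e i z := by
    -- With `p ∈ P i`, `q ∈ P j` and `p + q = 1`, both `p` and `q` kill the `j`-th component.
    have hcomp (j : I) (hj : j ≠ i) : f (e i (Ideal.Quotient.mk _ 1)) j = 0 := by
      obtain ⟨p, hp, q, hq, hpq⟩ := Ideal.isCoprime_iff_exists.1 (hcop hj.symm)
      set y := f (e i (Ideal.Quotient.mk _ 1)) with hy
      have h1 : p • y = 0 := by
        rw [hy, ← map_smul, ← map_smul, ← Ideal.Quotient.mk_eq_mk, ← Submodule.Quotient.mk_smul]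
        rw [(Submodule.Quotient.mk_eq_zero _).2 (by simpa using hp), map_zero, map_zero]
      have h2 : q • y j = 0 := by
        obtain ⟨r, hr⟩ := Ideal.Quotient.mk_surjective (y j)
        rw [← hr, ← Ideal.Quotient.mk_eq_mk, ← Submodule.Quotient.mk_smul]
        exact (Submodule.Quotient.mk_eq_zero _).2 (Ideal.mul_mem_right _ _ hq)
      calc y j = (p + q) • y j := by rw [hpq, one_smul]
        _ = (p • y) j + q • y j := by rw [add_smul, DirectSum.smul_apply]
        _ = 0 := by rw [h1, h2, DirectSum.zero_apply, add_zero]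
    obtain ⟨c, hc⟩ := Ideal.Quotient.mk_surjective (f (e i (Ideal.Quotient.mk _ 1)) i)
    have hone : f (e i (Ideal.Quotient.mk _ 1)) = c • e i (Ideal.Quotient.mk _ 1) := by
      ext j
      rw [DirectSum.smul_apply]
      by_cases hj : j = i
      · subst hj
        rw [← hc, DirectSum.lof_apply, Algebra.smul_def, map_one, mul_one]
        rfl
      · rw [hcomp j hj]
        simp only [e, DirectSum.lof_eq_of]
        rw [DirectSum.of_eq_of_ne _ _ _ hj, smul_zero]
    refine ⟨c, fun z ↦ ?_⟩
    obtain ⟨r, rfl⟩ := Ideal.Quotient.mk_surjective z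
    have hr : Ideal.Quotient.mk (P i).asIdeal r = r • Ideal.Quotient.mk (P i).asIdeal 1 := by
      rw [Algebra.smul_def, map_one, mul_one]; rfl
    rw [hr, map_smul, map_smul, hone, smul_comm]
  choose c hc using hscalar
  obtain ⟨r, hr⟩ := Ideal.exists_forall_sub_mem_ideal
    (I := fun i : x.support ↦ (P i).asIdeal) (fun i j hij ↦ hcop (Subtype.coe_injective.ne hij))
    (fun i ↦ c i)
  refine Submodule.mem_span_singleton.2 ⟨r, ?_⟩
  have hsum : ∑ i ∈ x.support, e i (x i) = x := DirectSum.sum_support_of x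
  rw [← hsum, map_sum, Finset.smul_sum]
  refine Finset.sum_congr rfl fun i hi ↦ ?_
  rw [hc i, ← sub_eq_zero, ← sub_smul, ← map_smul]
  obtain ⟨s, hs⟩ := Ideal.Quotient.mk_surjective (x i)
  have hzero : Submodule.Quotient.mk (p := (P i).asIdeal) ((r - c i) • s) = 0 :=
    (Submodule.Quotient.mk_eq_zero _).2 (Ideal.mul_mem_right s _ (hr ⟨i, hi⟩))
  rw [← hs, ← Ideal.Quotient.mk_eq_mk, ← Submodule.Quotient.mk_smul, hzero, map_zero]

/-- A Noetherian module contains the simple module `R ⧸ P` for only finitely many maximal ideals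
`P`, because the corresponding torsion submodules are independent. -/
theorem finite_of_linearEquiv_directSum_quotient [IsNoetherian R M] {I : Type*}
    {P : I → MaximalSpectrum R} (hP : Function.Injective P)
    (e : M ≃ₗ[R] ⨁ i : I, R ⧸ (P i).asIdeal) : Finite I := by
  classical
  have hfin := Submodule.finite_ne_bot_of_iSupIndep
    (iSupIndep_torsionBySet_maximalSpectrum (R := R) (M := M))
  rw [← Set.finite_univ_iff]
  refine Set.Finite.of_injOn (f := P) (fun i _ ↦ ?_) hP.injOn hfin
  let l := DirectSum.lof R I (fun i ↦ R ⧸ (P i).asIdeal) i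
  have hone : (1 : R ⧸ (P i).asIdeal) ≠ 0 :=
    haveI := Ideal.Quotient.nontrivial_iff.2 (P i).isMaximal.ne_top
    one_ne_zero
  refine (Submodule.ne_bot_iff _).2 ⟨e.symm (l 1), ?_, ?_⟩
  · rw [Submodule.mem_torsionBySet_iff]
    rintro ⟨a, ha⟩
    have hzero : a • (1 : R ⧸ (P i).asIdeal) = 0 := by
      rw [Algebra.smul_def, mul_one]
      exact Ideal.Quotient.eq_zero_iff_mem.2 ha
    change a • e.symm (l 1) = 0
    rw [← map_smul, ← map_smul, hzero, map_zero, map_zero]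
  · rw [Ne, e.symm.map_eq_zero_iff]
    intro h
    have hi := DirectSum.lof_apply (R := R) (M := fun i ↦ R ⧸ (P i).asIdeal) i 1
    exact hone (hi.symm.trans (congrArg (· i) h))

end Semisimple

/-! ### Torsion and finitely generated modules over a Dedekind domain -/

section Dedekind

variable {R : Type u} [CommRing R] [IsDedekindDomain R] {M : Type v} [AddCommGroup M] [Module R M]

/-- The quotient is Noetherian, reduced, and of Krull dimension zero. -/
theorem Ideal.isSemisimpleRing_quotient_of_isRadical {I : Ideal R} (hI : I ≠ ⊥)
    (hrad : I.IsRadical) : IsSemisimpleRing (R ⧸ I) := by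
  have : IsReduced (R ⧸ I) := (Ideal.isRadical_iff_quotient_reduced I).1 hrad
  have : Ring.KrullDimLE 0 (R ⧸ I) := .mk₀ fun Q hQ ↦ by
    have hle : I ≤ Q.comap (Ideal.Quotient.mk I) := fun a ha ↦ by
      rw [Ideal.mem_comap, Ideal.Quotient.eq_zero_iff_mem.2 ha]
      exact Q.zero_mem
    have hne : Q.comap (Ideal.Quotient.mk I) ≠ ⊥ := fun h ↦ hI (le_bot_iff.1 (h ▸ hle))
    have hmax : (Q.comap (Ideal.Quotient.mk I)).IsMaximal :=
      (hQ.comap (Ideal.Quotient.mk I)).isMaximal hne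
    have hmap := Ideal.map_comap_of_surjective (Ideal.Quotient.mk I) Ideal.Quotient.mk_surjective Q
    obtain h | h := Ideal.map_eq_top_or_isMaximal_of_surjective (Ideal.Quotient.mk I)
      Ideal.Quotient.mk_surjective hmax
    · exact absurd (hmap.symm.trans h) hQ.ne_top
    · exact hmap ▸ h
  have : IsArtinianRing (R ⧸ I) := isArtinianRing_iff_krullDimLE_zero.2 this
  exact IsArtinianRing.isSemisimpleRing_of_isReduced _

/-- Each cyclic submodule is isomorphic to `R ⧸ I` with `I` radical and non-zero, and `R ⧸ I` is a
semisimple ring. -/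
theorem IsStronglySelfRegular.isSemisimpleModule_of_isTorsion (h : IsStronglySelfRegular R M)
    (hM : Module.IsTorsion R M) : IsSemisimpleModule R M := by
  refine isSemisimpleModule_of_isSemisimpleModule_submodule' (p := fun x : M ↦ R ∙ x)
    (fun x ↦ ?_) (eq_top_iff.2 fun x _ ↦
      Submodule.mem_iSup_of_mem x (Submodule.mem_span_singleton_self x))
  set I : Ideal R := LinearMap.ker (LinearMap.toSpanSingleton R M x) with hI
  have hmem (a : R) : a ∈ I ↔ a • x = 0 := by simp [hI]
  have hbot : I ≠ ⊥ := by
    obtain ⟨a, ha⟩ := @hM x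
    exact fun h0 ↦ nonZeroDivisors.coe_ne_zero a ((Submodule.eq_bot_iff _).1 h0 _ ((hmem _).2 ha))
  have hrad : I.IsRadical := by
    rw [Ideal.isRadical_iff_quotient_reduced, isReduced_iff_pow_one_lt 2 one_lt_two]
    intro a ha
    obtain ⟨a, rfl⟩ := Ideal.Quotient.mk_surjective a
    rw [← map_pow, Ideal.Quotient.eq_zero_iff_mem, hmem, sq, mul_smul] at ha
    exact Ideal.Quotient.eq_zero_iff_mem.2
      ((hmem _).2 (h.smul_eq_zero_of_smul_smul_eq_zero ha))
  have := Ideal.isSemisimpleRing_quotient_of_isRadical hbot hrad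
  -- Submodules of `R ⧸ I` over `R` and over `R ⧸ I` are the same.
  let l : (R ⧸ I) →ₛₗ[Ideal.Quotient.mk I] (R ⧸ I) :=
    { AddMonoidHom.id _ with map_smul' := fun r y ↦ by simp [Algebra.smul_def] }
  have hss : IsSemisimpleModule R (R ⧸ I) :=
    (LinearMap.isSemisimpleModule_iff_of_bijective l Function.bijective_id).2 this
  rw [← LinearMap.range_toSpanSingleton]
  exact .congr (LinearMap.toSpanSingleton R M x).quotKerEquivRange.symm

/-- For a non-zero non-unit `r`, the finitely generated module `r M` satisfies `r M = r (r M)`, so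
Nakayama's lemma gives `s ≡ 1` modulo `r` with `s r M = 0`. -/
theorem IsStronglySelfRegular.isTorsion_of_finite (hR : ¬ IsField R)
    (h : IsStronglySelfRegular R M) [Module.Finite R M] : Module.IsTorsion R M := by
  obtain ⟨r, hr0, hr⟩ := Ring.exists_not_isUnit_of_not_isField hR
  obtain ⟨s, hs, hsN⟩ := Submodule.exists_sub_one_mem_and_smul_eq_zero_of_fg_of_le_smul
    (Ideal.span {r}) (LinearMap.range (LinearMap.lsmul R M r))
    (by rw [LinearMap.range_eq_map]; exact Module.Finite.fg_top.map _) (by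
      rintro _ ⟨x, rfl⟩
      obtain ⟨y, hy⟩ := h.exists_smul_smul_eq r x
      rw [LinearMap.lsmul_apply, ← hy]
      exact Submodule.smul_mem_smul (Ideal.mem_span_singleton_self r) ⟨y, rfl⟩)
  have hs0 : s ≠ 0 := by
    rintro rfl
    rw [zero_sub, Ideal.neg_mem_iff, Ideal.mem_span_singleton] at hs
    exact hr (isUnit_of_dvd_one hs)
  intro x
  refine ⟨⟨s * r, mem_nonZeroDivisors_of_ne_zero (mul_ne_zero hs0 hr0)⟩, ?_⟩
  exact (mul_smul s r x).trans (hsN _ ⟨x, rfl⟩)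

theorem IsStronglySelfRegular.isSemisimpleModule_of_finite (h : IsStronglySelfRegular R M)
    [Module.Finite R M] : IsSemisimpleModule R M := by
  by_cases hR : IsField R
  · let := hR.toField
    have : IsSemisimpleRing R := inferInstance
    infer_instance
  · exact h.isSemisimpleModule_of_isTorsion (h.isTorsion_of_finite hR)

theorem isStronglySelfRegular_iff_of_isTorsion (hM : Module.IsTorsion R M) :
    IsStronglySelfRegular R M ↔
      ∃ (I : Type u) (P : I → MaximalSpectrum R), Function.Injective P ∧
        Nonempty (M ≃ₗ[R] ⨁ i : I, R ⧸ (P i).asIdeal) := by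
  refine ⟨fun h ↦ ?_, fun ⟨I, P, hP, ⟨e⟩⟩ ↦
    (isStronglySelfRegular_directSum_quotient P hP).congr e.symm⟩
  have := h.isSemisimpleModule_of_isTorsion hM
  exact exists_linearEquiv_directSum_of_isSemisimpleModule fun f ↦ (h f).2.2

theorem isStronglySelfRegular_iff_of_finite [Module.Finite R M] :
    IsStronglySelfRegular R M ↔
      ∃ (k : ℕ) (P : Fin k → MaximalSpectrum R), Function.Injective P ∧
        Nonempty (M ≃ₗ[R] ⨁ i : Fin k, R ⧸ (P i).asIdeal) := by
  refine ⟨fun h ↦ ?_, fun ⟨k, P, hP, ⟨e⟩⟩ ↦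
    (isStronglySelfRegular_directSum_quotient P hP).congr e.symm⟩
  have := h.isSemisimpleModule_of_finite
  obtain ⟨I, P, hP, ⟨e⟩⟩ :=
    exists_linearEquiv_directSum_of_isSemisimpleModule fun f ↦ (h f).2.2
  have := finite_of_linearEquiv_directSum_quotient hP e
  obtain ⟨k, ⟨σ⟩⟩ := Finite.exists_equiv_fin I
  exact ⟨k, P ∘ σ.symm, hP.comp σ.symm.injective, ⟨e.trans (DirectSum.lequivCongrLeft R σ)⟩⟩

end Dedekind

/-! ### Injective modules and the field of fractions -/

section FractionField

variable {R : Type u} [CommRing R] (K : Type w) [Field K] [Algebra R K] {M : Type v}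
  [AddCommGroup M] [Module R M]

/-- Injective modules over a domain are divisible. -/
theorem Module.Injective.exists_smul_eq [IsDomain R] [Small.{v} R] (hM : Module.Injective R M)
    {r : R} (hr : r ≠ 0) (x : M) : ∃ y : M, r • y = x := by
  obtain ⟨g, hg⟩ := (Module.Baer.of_injective hM).extension_property
    (LinearMap.mulLeft R r) (mul_right_injective₀ hr) (LinearMap.toSpanSingleton R M x)
  refine ⟨g 1, ?_⟩
  have := congrFun (congrArg DFunLike.coe hg) 1
  simpa [← map_smul] using this

theorem isStronglySelfRegular_fractionRing [IsFractionRing R K] : IsStronglySelfRegular R K := by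
  intro f
  have hbot : IsFullyInvariantSummand (⊥ : Submodule R K) :=
    ⟨isComplemented_bot, fun g x hx ↦ by simp_all⟩
  have htop : IsFullyInvariantSummand (⊤ : Submodule R K) :=
    ⟨isComplemented_top, fun _ _ _ ↦ trivial⟩
  have hf (x : K) : f x = x * f 1 := by
    simpa using (f.extendScalarsOfIsLocalization R⁰ K).map_smul x 1
  by_cases h1 : f 1 = 0
  · have : f = 0 := LinearMap.ext fun x ↦ by rw [hf, h1, mul_zero, LinearMap.zero_apply]
    rw [this, LinearMap.ker_zero, LinearMap.range_zero]
    exact ⟨htop, hbot⟩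
  · rw [LinearMap.ker_eq_bot'.2 fun x hx ↦ (mul_eq_zero.1 ((hf x).symm.trans hx)).resolve_right h1,
      LinearMap.range_eq_top.2 fun y ↦ ⟨y / f 1, by rw [hf, div_mul_cancel₀ _ h1]⟩]
    exact ⟨hbot, htop⟩

/-- A non-zero `K`-vector space that is strongly self-regular over `R` has dimension one: all of its
`K`-linear endomorphisms are `R`-linear and so have image invariant under `K`-linear maps. -/
theorem IsStronglySelfRegular.nonempty_linearEquiv_of_isScalarTower [Nontrivial M] [Module K M]
    [IsScalarTower R K M] (h : IsStronglySelfRegular R M) : Nonempty (M ≃ₗ[R] K) := by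
  obtain ⟨x, hx⟩ := exists_ne (0 : M)
  have hinv (f : M →ₗ[K] M) : (LinearMap.range f).IsFullyInvariant := fun g ↦
    (h (f.restrictScalars R)).2.2 (g.restrictScalars R)
  have hspan (y : M) : y ∈ K ∙ x := by
    -- Over the field `K`, every vector is killed by the maximal ideal `⊥`.
    have := mem_span_singleton_of_range_isFullyInvariant hinv (⊥ : Ideal K) (y := y) hx
    exact this (by simp) (by simp)
  have e := LinearEquiv.ofBijective (LinearMap.toSpanSingleton K M x)
    ⟨smul_left_injective K hx, fun y ↦ Submodule.mem_span_singleton.1 (hspan y)⟩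
  exact ⟨(e.restrictScalars R).symm⟩

/-- A strongly self-regular injective module is divisible and torsion-free, so it is its own
localization at the non-zero elements of `R`, that is, a vector space over `K`. -/
theorem IsStronglySelfRegular.nonempty_linearEquiv_of_injective [IsDomain R]
    [IsFractionRing R K] [Nontrivial M] [Small.{v} R] (hM : Module.Injective R M)
    (h : IsStronglySelfRegular R M) : Nonempty (M ≃ₗ[R] K) := by
  have hbij (s : R⁰) : Function.Bijective (algebraMap R (Module.End R M) s) := by
    have hs := nonZeroDivisors.coe_ne_zero s
    refine ⟨(injective_iff_map_eq_zero _).2 fun x hx ↦ ?_, hM.exists_smul_eq hs⟩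
    obtain ⟨y, rfl⟩ := hM.exists_smul_eq hs x
    exact h.smul_eq_zero_of_smul_smul_eq_zero hx
  have hloc : IsLocalizedModule R⁰ (LinearMap.id : M →ₗ[R] M) :=
    { map_units s := (Module.End.isUnit_iff _).2 (hbij s)
      surj y := ⟨(y, 1), by simp⟩
      exists_of_eq {x y} hxy := ⟨1, by simpa using hxy⟩ }
  let e : LocalizedModule R⁰ M ≃ₗ[R] M := IsLocalizedModule.iso R⁰ LinearMap.id
  let : Module K (LocalizedModule R⁰ M) := LocalizedModule.moduleOfIsLocalization
  have : IsScalarTower R K (LocalizedModule R⁰ M) := inferInstance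
  have : Nontrivial (LocalizedModule R⁰ M) := e.toEquiv.nontrivial
  obtain ⟨e'⟩ := (h.congr e.symm).nonempty_linearEquiv_of_isScalarTower K
  exact ⟨e.symm.trans e'⟩

theorem isStronglySelfRegular_iff_of_injective [IsDomain R] [IsFractionRing R K] [Nontrivial M]
    [Small.{v} R] (hM : Module.Injective R M) :
    IsStronglySelfRegular R M ↔ Nonempty (M ≃ₗ[R] K) :=
  ⟨fun h ↦ h.nonempty_linearEquiv_of_injective K hM,
    fun ⟨e⟩ ↦ (isStronglySelfRegular_fractionRing K).congr e.symm⟩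

end FractionField

/-! ### The integers -/

section Integers

theorem Nat.Prime.isMaximal_span_natCast {p : ℕ} (hp : p.Prime) :
    (Ideal.span {(p : ℤ)}).IsMaximal :=
  PrincipalIdealRing.isMaximal_of_irreducible (Nat.prime_iff_prime_int.1 hp).irreducible

/-- Prime numbers correspond to maximal ideals of `ℤ` through `p ↦ (p)`. -/
noncomputable def Nat.Primes.equivMaximalSpectrumInt : Nat.Primes ≃ MaximalSpectrum ℤ :=
  .ofBijective (fun p ↦ ⟨Ideal.span {((p : ℕ) : ℤ)}, p.2.isMaximal_span_natCast⟩) <| by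
    refine ⟨fun p q hpq ↦ ?_, fun P ↦ ?_⟩
    · have h := congrArg MaximalSpectrum.asIdeal hpq
      rw [Ideal.span_singleton_eq_span_singleton, Int.associated_iff_natAbs] at h
      exact Subtype.ext (by simpa using h)
    · obtain ⟨P, hP⟩ := P
      obtain ⟨n, rfl⟩ : ∃ n : ℕ, P = Ideal.span {(n : ℤ)} := by
        obtain ⟨a, rfl⟩ := (IsPrincipalIdealRing.principal P).principal
        exact ⟨a.natAbs, (Int.span_natAbs a).symm⟩
      have hn : (n : ℤ) ≠ 0 := fun h ↦ by
        rw [h, Ideal.span_singleton_zero] at hP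
        exact Int.not_isField (Ring.isField_iff_maximal_bot.2 hP)
      exact ⟨⟨n, Nat.prime_iff_prime_int.2 ((Ideal.span_singleton_prime hn).1 hP.isPrime)⟩, rfl⟩

theorem exists_maximalSpectrum_int_iff {G : Type*} [AddCommGroup G] {I : Type*} :
    (∃ P : I → MaximalSpectrum ℤ, Function.Injective P ∧
      Nonempty (G ≃ₗ[ℤ] ⨁ i : I, ℤ ⧸ (P i).asIdeal)) ↔
    ∃ p : I → Nat.Primes, Function.Injective p ∧ Nonempty (G ≃+ ⨁ i : I, ZMod (p i)) := by
  have e (p : I → Nat.Primes) :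
      (⨁ i : I, ℤ ⧸ (Nat.Primes.equivMaximalSpectrumInt (p i)).asIdeal) ≃+ ⨁ i : I, ZMod (p i) :=
    DirectSum.congrAddEquiv fun i ↦ (Int.quotientSpanNatEquivZMod (p i)).toAddEquiv
  constructor
  · rintro ⟨P, hP, ⟨f⟩⟩
    obtain ⟨p, rfl⟩ : ∃ p : I → Nat.Primes, P = Nat.Primes.equivMaximalSpectrumInt ∘ p :=
      ⟨Nat.Primes.equivMaximalSpectrumInt.symm ∘ P, by ext; simp⟩
    exact ⟨p, hP.of_comp, ⟨f.toAddEquiv.trans (e p)⟩⟩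
  · rintro ⟨p, hp, ⟨f⟩⟩
    exact ⟨_, Nat.Primes.equivMaximalSpectrumInt.injective.comp hp,
      ⟨(f.trans (e p).symm).toIntLinearEquiv⟩⟩

end Integers

/-! ### Classification over Dedekind domains and for abelian groups -/

theorem corollaryc :
    -- modules over a Dedekind domain `R` with quotient field `K`
    (∀ (R : Type u) [CommRing R] [IsDedekindDomain R]
        (K : Type w) [Field K] [Algebra R K] [IsFractionRing R K]
        (M : Type v) [AddCommGroup M] [Module R M] [Nontrivial M],
      -- torsion modules
      (Module.IsTorsion R M →
        (IsStronglySelfRegular R M ↔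
          ∃ (I : Type u) (P : I → MaximalSpectrum R), Function.Injective P ∧
            Nonempty (M ≃ₗ[R] ⨁ i : I, R ⧸ (P i).asIdeal))) ∧
      -- finitely generated modules
      (Module.Finite R M →
        (IsStronglySelfRegular R M ↔
          ∃ (k : ℕ) (P : Fin k → MaximalSpectrum R), Function.Injective P ∧
            Nonempty (M ≃ₗ[R] ⨁ i : Fin k, R ⧸ (P i).asIdeal))) ∧
      -- injective modules; `Small.{v} R` says that the universe of `M` is large enough for
      -- `Module.Injective` to mean injectivity
      (Small.{v} R → Module.Injective R M →
        (IsStronglySelfRegular R M ↔ Nonempty (M ≃ₗ[R] K)))) ∧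
    -- abelian groups
    (∀ (G : Type x) [AddCommGroup G] [Nontrivial G],
      (IsAddTorsion G →
        (IsStronglySelfRegular ℤ G ↔
          ∃ (I : Type) (p : I → Nat.Primes), Function.Injective p ∧
            Nonempty (G ≃+ ⨁ i : I, ZMod (p i)))) ∧
      (AddGroup.FG G →
        (IsStronglySelfRegular ℤ G ↔
          ∃ (k : ℕ) (p : Fin k → Nat.Primes), Function.Injective p ∧
            Nonempty (G ≃+ ⨁ i : Fin k, ZMod (p i)))) ∧
      (Module.Injective ℤ G →
        (IsStronglySelfRegular ℤ G ↔ Nonempty (G ≃+ ℚ)))) := by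
  refine ⟨fun R _ _ K _ _ _ M _ _ _ ↦ ⟨isStronglySelfRegular_iff_of_isTorsion,
    fun _ ↦ isStronglySelfRegular_iff_of_finite,
    fun _ ↦ isStronglySelfRegular_iff_of_injective K⟩, fun G _ _ ↦ ⟨fun hG ↦ ?_, fun hG ↦ ?_,
    fun hG ↦ ?_⟩⟩
  · rw [isStronglySelfRegular_iff_of_isTorsion (isAddTorsion_iff_isTorsion_int.1 hG)]
    exact exists_congr fun _ ↦ exists_maximalSpectrum_int_iff
  · have : Module.Finite ℤ G := Module.Finite.iff_addGroup_fg.2 hG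
    rw [isStronglySelfRegular_iff_of_finite]
    exact exists_congr fun _ ↦ exists_maximalSpectrum_int_iff
  · rw [isStronglySelfRegular_iff_of_injective ℚ hG]
    exact ⟨fun ⟨e⟩ ↦ ⟨e.toAddEquiv⟩, fun ⟨e⟩ ↦ ⟨e.toIntLinearEquiv⟩⟩
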